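/- Let $G$ be a countable discrete group with a sofic approximation $\sigma_k\colon G\to S_{d_k}$ ($k\in\mathbb N$, $d_k\ge 1$): the $\sigma_k$ are maps, not necessarily homomorphisms, such that, writing $u_d$ for the uniform probability measure on $\{1,\dots,d\}$, for all $g,h\in G$ we have $\lim_{k\to\infty}u_{d_k}(\{j:\sigma_k(gh)(j)=\sigma_k(g)\sigma_k(h)(j)\})=1$, and $\lim_{k\to\infty}u_{d_k}(\{j:\sigma_k(g)(j)\ne\sigma_k(h)(j)\})=1$ whenever $g\neq h$. Let $X$ be a compact metrizable group with a compatible metric $\rho$ and normalized Haar measure $m_X$, let $G$ act on $X$ by continuous automorphisms, and let $\omega$ be a free ultrafilter on $\mathbb N$. Let $\mathrm{Prob}(\cdot)$ denote Borel probability measures with the weak$^*$ topology, and let $\mathrm{Sub}(X)$ be the space of closed subgroups of $X$ with the Hausdorff metric. Definitions. - A sequence $\phi_k\colon\{1,\dots,d_k\}\to X$ is a sequence of topological microstates along $\omega$ if $\lim_{k\to\omega}u_{d_k}(\{j:(g\phi_k(j),\phi_k(\sigma_k(g)(j)))\in U\})=1$ for every $g\in G$ and every neighborhood $U$ of the diagonal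 in $X\times X$. - A sequence $\mu_k\in\mathrm{Prob}(X^{d_k})$ is asymptotically supported on topological microstates as $k\to\omega$ if, for every $g\in G$, every open neighborhood $U$ of the diagonal in $X\times X$ and every $\delta>0$, $\lim_{k\to\omega}\mu_k(\{\phi\in X^{d_k}:u_{d_k}(\{j:(\phi(\sigma_k(g)(j)),g\phi(j))\in U\})>1-\delta\})=1$. - A sequence $\mu_k\in\mathrm{Prob}(X^{d_k})$ locally weak$^*$ converges to $\mu\in\mathrm{Prob}(X)$ as $k\to\omega$ if, for every weak$^*$ neighborhood $\mathcal O$ of $\mu$, $\lim_{k\to\omega}u_{d_k}(\{j:\mu_{k,j}\in\mathcal O\})=1$, where $\mu_{k,j}$ is the $j$-th marginal of $\mu_k$. - A sequence $(Y_k)_k\in\prod_k\mathrm{Sub}(X)^{d_k}$ absorbs all topological microstates along $\omega$ if, for every sequence $(\phi_k)_k$ of topological microstates along $\omega$ and every $\varepsilon>0$, $\lim_{k\to\omega}u_{d_k}(\{j:\rho(\phi_k(j),Y_k(j))<\varepsilon\})=1$. Then the following are equivalent. 1. There is no sequence $\mu_k\in\mathrm{Prob}(X^{d_k})$ which is asymptotically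 supported on topological microstates as $k\to\omega$ and which locally weak$^*$ converges to $m_X$ as $k\to\omega$. 2. There is a sequence $(Y_k)_k\in\prod_k\mathrm{Sub}(X)^{d_k}$ which absorbs all topological microstates along $\omega$ and such that the empirical distributions $(Y_k)_*(u_{d_k})\in\mathrm{Prob}(\mathrm{Sub}(X))$ do not converge along $\omega$ to the point mass $\delta_X$ at $X\in\mathrm{Sub}(X)$. -/

import Mathlib

open Filter Topology MeasureTheory

noncomputable section

namespace SoficMicrostates

/-- The uniform probability measure `u_d` on `{1, …, d}` (here `Fin d`), for `d ≥ 1`. -/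
def unif (d : ℕ) [NeZero d] : ProbabilityMeasure (Fin d) :=
  ⟨ProbabilityTheory.uniformOn Set.univ, inferInstance⟩

/-- An ultrafilter on the natural numbers is free if no finite set belongs to it. -/
def IsFree (ω : Ultrafilter ℕ) : Prop :=
  ∀ s : Set ℕ, s.Finite → s ∉ ω

/-- A sofic approximation of `G`: maps `σ_k : G → S_{d_k}` (not assumed to be homomorphisms) that
are asymptotically multiplicative and asymptotically free. -/
structure IsSoficApproximation {G : Type*} [Group G] {d : ℕ → ℕ} [∀ k, NeZero (d k)]
    (σ : ∀ k, G → Equiv.Perm (Fin (d k))) : Prop where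
  multiplicative : ∀ g h : G,
    Tendsto (fun k => unif (d k) {j | σ k (g * h) j = σ k g (σ k h j)}) atTop (𝓝 1)
  free : ∀ g h : G, g ≠ h →
    Tendsto (fun k => unif (d k) {j | σ k g j ≠ σ k h j}) atTop (𝓝 1)

/-- `(φ_k)` is a sequence of topological microstates with respect to `(σ_k)`, `ω`. -/
def IsMicrostateSeq {G X : Type*} [Group G] [TopologicalSpace X] [MulAction G X]
    {d : ℕ → ℕ} [∀ k, NeZero (d k)] (σ : ∀ k, G → Equiv.Perm (Fin (d k))) (ω : Ultrafilter ℕ)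
    (φ : ∀ k, Fin (d k) → X) : Prop :=
  ∀ g : G, ∀ U ∈ 𝓝ˢ (Set.diagonal X),
    Tendsto (fun k => unif (d k) {j | (g • φ k j, φ k (σ k g j)) ∈ U}) ω (𝓝 1)

/-- The probability measures `μ_k` on `X^{d_k}` are asymptotically supported on topological
microstates as `k → ω`. -/
def AsympSupportedOnMicrostates {G X : Type*} [Group G] [TopologicalSpace X] [MeasurableSpace X]
    [MulAction G X] {d : ℕ → ℕ} [∀ k, NeZero (d k)] (σ : ∀ k, G → Equiv.Perm (Fin (d k)))
    (ω : Ultrafilter ℕ) (μ : ∀ k, ProbabilityMeasure (Fin (d k) → X)) : Prop :=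
  ∀ g : G, ∀ U : Set (X × X), IsOpen U → Set.diagonal X ⊆ U → ∀ δ : ℝ, 0 < δ →
    Tendsto (fun k => μ k
      {φ | 1 - δ < (unif (d k) {j | (φ (σ k g j), g • φ j) ∈ U} : ℝ)}) ω (𝓝 1)

/-- The marginal `(ℰ_j)_* μ` of a probability measure `μ` on `X^d` on the `j`-th coordinate. -/
def marginal {X : Type*} [MeasurableSpace X] {d : ℕ} (μ : ProbabilityMeasure (Fin d → X))
    (j : Fin d) : ProbabilityMeasure X :=
  μ.map (f := fun x => x j) (measurable_pi_apply j).aemeasurable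

/-- Local weak* convergence of `(μ_k)` to `ν` as `k → ω`. The topology on `ProbabilityMeasure X`
is the weak* topology. -/
def LocalWeakStarTendsto {X : Type*} [TopologicalSpace X] [MeasurableSpace X]
    [OpensMeasurableSpace X] {d : ℕ → ℕ} [∀ k, NeZero (d k)] (ω : Ultrafilter ℕ)
    (μ : ∀ k, ProbabilityMeasure (Fin (d k) → X)) (ν : ProbabilityMeasure X) : Prop :=
  ∀ O ∈ 𝓝 ν, Tendsto (fun k => unif (d k) {j | marginal (μ k) j ∈ O}) ω (𝓝 1)

/-- The Haar probability measure `m_X` of a compact group. -/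
def haarProb (X : Type*) [Group X] [TopologicalSpace X] [IsTopologicalGroup X] [CompactSpace X]
    [MeasurableSpace X] [BorelSpace X] : ProbabilityMeasure X :=
  ⟨Measure.haarMeasure ⊤, ⟨Measure.haarMeasure_self⟩⟩

section Sub

variable {X : Type*} [Group X] [MetricSpace X] [CompactSpace X]

/-- A closed subgroup of a compact group, regarded as a nonempty compact set. -/
def toNonemptyCompacts (H : ClosedSubgroup X) : TopologicalSpace.NonemptyCompacts X :=
  ⟨⟨(H : Set X), H.isClosed'.isCompact⟩, ⟨1, one_mem H⟩⟩

theorem toNonemptyCompacts_injective :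
    Function.Injective (toNonemptyCompacts : ClosedSubgroup X → _) := by
  intro H K h
  exact SetLike.coe_injective (congrArg (fun S : TopologicalSpace.NonemptyCompacts X => (S : Set X)) h)

/-- The space `Sub(X)` of closed subgroups carries the Hausdorff metric. -/
instance instMetricSpaceSub : MetricSpace (ClosedSubgroup X) :=
  MetricSpace.induced toNonemptyCompacts toNonemptyCompacts_injective inferInstance

instance instMeasurableSpaceSub : MeasurableSpace (ClosedSubgroup X) :=
  borel _

instance instBorelSpaceSub : BorelSpace (ClosedSubgroup X) :=
  ⟨rfl⟩

/-- The whole group `X` as a point of `Sub(X)`. -/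
def wholeGroup (X : Type*) [Group X] [MetricSpace X] : ClosedSubgroup X :=
  ⟨⊤, isClosed_univ⟩

/-- The empirical distribution `Y_* u_d` of `Y ∈ Sub(X)^d`. -/
def empirical {d : ℕ} [NeZero d] (Y : Fin d → ClosedSubgroup X) :
    ProbabilityMeasure (ClosedSubgroup X) :=
  (unif d).map (f := Y) (measurable_of_finite Y).aemeasurable

/-- `(Y_k)` absorbs all topological microstates along `ω`. -/
def AbsorbsMicrostates {G : Type*} [Group G] [MulAction G X]
    {d : ℕ → ℕ} [∀ k, NeZero (d k)] (σ : ∀ k, G → Equiv.Perm (Fin (d k))) (ω : Ultrafilter ℕ)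
    (Y : ∀ k, Fin (d k) → ClosedSubgroup X) : Prop :=
  ∀ φ : ∀ k, Fin (d k) → X, IsMicrostateSeq σ ω φ → ∀ ε : ℝ, 0 < ε →
    Tendsto (fun k => unif (d k) {j | Metric.infDist (φ k j) (Y k j : Set X) < ε}) ω (𝓝 1)

end Sub

end SoficMicrostates

end

noncomputable section

namespace SoficMicrostates

/-! Because `G` acts by automorphisms, microstate sequences form a group under pointwise
multiplication (`microstates`). At each scale, compactness of `X` yields finitely many of them that
absorb any others at most coordinates (`exists_finite_absorbing`). Their quotients are absorbed too,
so at a typical coordinate their values lie near a closed subgroup. Shrinking the scale gives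
`exists_closedSubgroup_hull`: a field `Y` of closed subgroups that absorbs every microstate sequence
and is no larger than needed, being approximated at each scale by the values of finitely many
microstate sequences.

If this hull tends to `X`, then at each scale finitely many microstate sequences have dense values
at most coordinates. Random words in them are again microstates, and averaging over the word length
makes their values nearly Haar distributed (`exists_equidistributing_words`). The law of the words
does not depend on the coordinate, so it is a single measure on maps, and a diagonal choice produces
the measures excluded by (1). Under (1) the hull therefore witnesses (2).

Conversely, suppose such measures exist and `Y` absorbs. Mass on maps far from `Y` at many
coordinates would allow a non-absorbed microstate sequence to be selected
(`eventually_measure_far_lt`). Hence most marginals concentrate near `Y`; being close to Haar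
measure, they charge every ball of a finite net, which forces `Y` close to `X`
(`exists_nhds_haarProb_dist_lt`). -/

theorem tendsto_one_iff {ι : Type*} {l : Filter ι} {f : ι → NNReal} (hf : ∀ k, f k ≤ 1) :
    Tendsto f l (𝓝 1) ↔ ∀ ε : ℝ, 0 < ε → ∀ᶠ k in l, 1 - ε < (f k : ℝ) := by
  rw [← NNReal.tendsto_coe, Metric.tendsto_nhds]
  refine forall₂_congr fun ε _ => eventually_congr (Eventually.of_forall fun k => ?_)
  have : (f k : ℝ) ≤ 1 := by exact_mod_cast hf k
  rw [Real.dist_eq, NNReal.coe_one, abs_of_nonpos (by linarith)]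
  constructor <;> intro h <;> linarith

/-- The proportion of `{1, …, d}` occupied by a set, as a real number. -/
def frac {d : ℕ} [NeZero d] (s : Set (Fin d)) : ℝ := (unif d s : ℝ)

/-! ### Proportions of coordinates and diagonalisation -/

section frac

variable {d : ℕ} [NeZero d] {s t : Set (Fin d)}

theorem frac_eq_real (s : Set (Fin d)) : frac s = (unif d : Measure (Fin d)).real s := by
  simp [frac]

theorem frac_nonneg : 0 ≤ frac s := NNReal.coe_nonneg _

theorem frac_le_one : frac s ≤ 1 := by
  have := (unif d).apply_le_one s
  exact_mod_cast this

theorem frac_mono (h : s ⊆ t) : frac s ≤ frac t := by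
  have := (unif d).apply_mono h
  exact_mod_cast this

theorem frac_union_le (s t : Set (Fin d)) : frac (s ∪ t) ≤ frac s + frac t := by
  have := (unif d).apply_union_le (s₁ := s) (s₂ := t)
  exact_mod_cast this

theorem frac_le_add {u : Set (Fin d)} (h : u ⊆ s ∪ t) : frac u ≤ frac s + frac t :=
  (frac_mono h).trans (frac_union_le s t)

theorem frac_compl (s : Set (Fin d)) : frac sᶜ = 1 - frac s := by
  rw [frac_eq_real, frac_eq_real, probReal_compl_eq_one_sub s.toFinite.measurableSet]

theorem frac_empty : frac (∅ : Set (Fin d)) = 0 := by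
  simp [frac_eq_real]

theorem frac_union_of_disjoint (h : Disjoint s t) : frac (s ∪ t) = frac s + frac t := by
  simp only [frac_eq_real]
  exact measureReal_union h t.toFinite.measurableSet

theorem frac_iUnion_le {ι : Type*} [Fintype ι] (s : ι → Set (Fin d)) :
    frac (⋃ i, s i) ≤ ∑ i, frac (s i) := by
  simp only [frac_eq_real]
  exact measureReal_iUnion_fintype_le _

end frac

section tendsto

variable {ι : Type*} {l : Filter ι} {d : ι → ℕ} [∀ k, NeZero (d k)]

theorem tendsto_unif_iff (A : ∀ k, Set (Fin (d k))) :
    Tendsto (fun k => unif (d k) (A k)) l (𝓝 1) ↔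
      ∀ ε : ℝ, 0 < ε → ∀ᶠ k in l, frac (A k)ᶜ < ε := by
  rw [tendsto_one_iff fun k => (unif (d k)).apply_le_one _]
  refine forall₂_congr fun ε _ => eventually_congr (Eventually.of_forall fun k => ?_)
  rw [frac_compl, frac]
  constructor <;> intro h <;> linarith

end tendsto

/-- Diagonalisation along a free ultrafilter. -/
theorem exists_diagonal {ω : Ultrafilter ℕ} (hω : IsFree ω) {P : ℕ → ℕ → Prop}
    (hP : ∀ n, ∀ᶠ k in ω, P n k) :
    ∃ m : ℕ → ℕ, (∀ n, ∀ᶠ k in ω, n ≤ m k) ∧ ∀ᶠ k in ω, P (m k) k := by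
  classical
  have hlarge : ∀ n, ∀ᶠ k in (ω : Filter ℕ), n ≤ k := by
    intro n
    have h := hω {k | k < n} (Set.finite_lt_nat n)
    have h2 := (Ultrafilter.compl_mem_iff_notMem).2 h
    filter_upwards [h2] with k hk
    simpa using hk
  -- The search is capped at `k` so that a greatest index exists; freeness of `ω` makes the cap
  -- exceed any given `n`.
  refine ⟨fun k => Nat.findGreatest (fun n => P n k) k, fun n => ?_, ?_⟩
  · filter_upwards [hlarge n, hP n] with k h1 h2
    exact Nat.le_findGreatest h1 h2
  · filter_upwards [hP 0] with k h0
    exact Nat.findGreatest_spec (P := fun n => P n k) (Nat.zero_le k) h0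

theorem exists_dist_mul_lt {X : Type*} [Group X] [MetricSpace X] [CompactSpace X]
    [IsTopologicalGroup X] {ε : ℝ} (hε : 0 < ε) :
    ∃ δ > 0, ∀ a a' b b' : X, dist a a' < δ → dist b b' < δ → dist (a * b) (a' * b') < ε := by
  have h : UniformContinuous fun p : X × X => p.1 * p.2 :=
    CompactSpace.uniformContinuous_of_continuous continuous_mul
  obtain ⟨δ, hδ, h⟩ := Metric.uniformContinuous_iff.1 h ε hε
  refine ⟨δ, hδ, fun a a' b b' h1 h2 => h (a := (a, b)) (b := (a', b')) ?_⟩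
  simpa [Prod.dist_eq] using ⟨h1, h2⟩

/-! ### The group of microstate sequences -/

section microstates

variable {G X : Type*} [Group G] [MetricSpace X] [CompactSpace X]
  {d : ℕ → ℕ} [∀ k, NeZero (d k)] {σ : ∀ k, G → Equiv.Perm (Fin (d k))} {ω : Ultrafilter ℕ}

theorem isMicrostateSeq_iff [MulAction G X] {φ : ∀ k, Fin (d k) → X} :
    IsMicrostateSeq σ ω φ ↔ ∀ g : G, ∀ ε : ℝ, 0 < ε → ∀ τ : ℝ, 0 < τ →
      ∀ᶠ k in ω, frac {j | ε ≤ dist (g • φ k j) (φ k (σ k g j))} < τ := by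
  refine forall_congr' fun g => ⟨fun h ε hε => ?_, fun h U hU => ?_⟩
  · have := (tendsto_unif_iff _).1 (h {p | dist p.1 p.2 < ε} (by
      rw [nhdsSet_diagonal_eq_uniformity]; exact Metric.dist_mem_uniformity hε))
    simpa [Set.compl_ofPred] using this
  · rw [nhdsSet_diagonal_eq_uniformity] at hU
    obtain ⟨ε, hε, hU⟩ := Metric.mem_uniformity_dist.1 hU
    rw [tendsto_unif_iff]
    intro τ hτ
    filter_upwards [h ε hε τ hτ] with k hk
    refine (frac_mono fun j hj => ?_).trans_lt hk
    by_contra hj'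
    exact hj (hU (not_le.1 hj'))

variable [Group X] [MulDistribMulAction G X]

theorem IsMicrostateSeq.one : IsMicrostateSeq σ ω (1 : ∀ k, Fin (d k) → X) := by
  rw [isMicrostateSeq_iff]
  intro g ε hε τ hτ
  refine Eventually.of_forall fun k => ?_
  simp [not_le.2 hε, frac_empty, hτ]

variable [IsTopologicalGroup X]

theorem IsMicrostateSeq.mul {φ ψ : ∀ k, Fin (d k) → X} (hφ : IsMicrostateSeq σ ω φ)
    (hψ : IsMicrostateSeq σ ω ψ) : IsMicrostateSeq σ ω (φ * ψ) := by
  rw [isMicrostateSeq_iff] at *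
  intro g ε hε τ hτ
  obtain ⟨δ, hδ, h⟩ := exists_dist_mul_lt (X := X) hε
  filter_upwards [hφ g δ hδ (τ / 2) (half_pos hτ), hψ g δ hδ (τ / 2) (half_pos hτ)] with k h1 h2
  refine (frac_le_add (u := {j | ε ≤ _}) fun j hj => ?_).trans_lt
    ((add_lt_add h1 h2).trans_eq (add_halves τ))
  by_contra hc
  simp only [Set.mem_union, Set.mem_ofPred_eq, not_or, not_le] at hc hj
  refine absurd (h _ _ _ _ hc.1 hc.2) (not_lt.2 ?_)
  simpa [smul_mul'] using hj

theorem IsMicrostateSeq.inv {φ : ∀ k, Fin (d k) → X} (hφ : IsMicrostateSeq σ ω φ) :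
    IsMicrostateSeq σ ω φ⁻¹ := by
  rw [isMicrostateSeq_iff] at *
  intro g ε hε τ hτ
  have hu : UniformContinuous fun x : X => x⁻¹ :=
    CompactSpace.uniformContinuous_of_continuous continuous_inv
  obtain ⟨δ, hδ, h⟩ := Metric.uniformContinuous_iff.1 hu ε hε
  filter_upwards [hφ g δ hδ τ hτ] with k h1
  refine (frac_mono fun j hj => ?_).trans_lt h1
  by_contra hc
  simp only [Set.mem_ofPred_eq, not_le] at hc hj
  refine absurd (h hc) (not_lt.2 ?_)
  simpa [smul_inv'] using hj

variable (X σ ω) in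
/-- The group of sequences of topological microstates. -/
def microstates : Subgroup (∀ k, Fin (d k) → X) where
  carrier := {φ | IsMicrostateSeq σ ω φ}
  mul_mem' := IsMicrostateSeq.mul
  one_mem' := IsMicrostateSeq.one
  inv_mem' := IsMicrostateSeq.inv

end microstates

end SoficMicrostates

namespace SoficMicrostates

/-! ### Absorption by finite subfamilies -/

section absorbing

variable {X : Type*} [MetricSpace X] [CompactSpace X] {d : ℕ → ℕ} [∀ k, NeZero (d k)]

/-- Any family of sequences of maps into a compact metric space is approximately absorbed by a
finite subfamily, uniformly over the family. -/
theorem exists_finite_absorbing (M : Set (∀ k, Fin (d k) → X)) {φ₀ : ∀ k, Fin (d k) → X}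
    (hφ₀ : φ₀ ∈ M) (ω : Ultrafilter ℕ) {ε : ℝ} (hε : 0 < ε) :
    ∃ S : Set (∀ k, Fin (d k) → X), S.Finite ∧ S ⊆ M ∧ φ₀ ∈ S ∧
      ∀ T : Set (∀ k, Fin (d k) → X), T.Finite → T ⊆ M → ∀ᶠ k in ω,
        frac {j | ∃ φ ∈ T, ∀ ψ ∈ S, ε ≤ dist (φ k j) (ψ k j)} < ε := by
  classical
  by_contra! hcon
  obtain ⟨t, -, htf, ht⟩ := finite_cover_balls_of_compact (isCompact_univ (X := X)) (half_pos hε)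
  lift t to Finset X using htf
  let hit (S : Set (∀ k, Fin (d k) → X)) (k : ℕ) (c : X) : Set (Fin (d k)) :=
    {j | ∃ ψ ∈ S, dist (ψ k j) c < ε / 2}
  -- The potential is the sum, over a finite `ε / 2`-net, of the proportion of coordinates where `S`
  -- visits the ball. Each failure of absorption raises it by `ε`, yet it never exceeds the size of
  -- the net.
  have key : ∀ n : ℕ, ∃ S : Set (∀ k, Fin (d k) → X), S.Finite ∧ S ⊆ M ∧ φ₀ ∈ S ∧
      ∀ᶠ k in ω, n * ε ≤ ∑ c ∈ t, frac (hit S k c) := by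
    intro n
    induction n with
    | zero =>
      refine ⟨{φ₀}, Set.finite_singleton _, by simpa using hφ₀, rfl, Eventually.of_forall fun k => ?_⟩
      simpa using Finset.sum_nonneg fun c _ => frac_nonneg
    | succ n ih =>
      obtain ⟨S, hSf, hSM, h0, hS⟩ := ih
      obtain ⟨T, hTf, hTM, hT⟩ := hcon S hSf hSM h0
      refine ⟨S ∪ T, hSf.union hTf, Set.union_subset hSM hTM, Or.inl h0, ?_⟩
      filter_upwards [hS, hT] with k h1 h2
      have hsplit : ∀ c ∈ t, frac (hit S k c) + frac (hit T k c \ hit S k c) ≤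
          frac (hit (S ∪ T) k c) := by
        intro c _
        rw [← frac_union_of_disjoint Set.disjoint_sdiff_right]
        refine frac_mono ?_
        rintro j (⟨ψ, hψ, h⟩ | ⟨⟨ψ, hψ, h⟩, -⟩)
        exacts [⟨ψ, Or.inl hψ, h⟩, ⟨ψ, Or.inr hψ, h⟩]
      -- A value at distance at least `ε` from all values of `S` lies in a net ball that `S` misses
      -- at that coordinate.
      have hcov : ε ≤ ∑ c ∈ t, frac (hit T k c \ hit S k c) := by
        refine h2.trans ?_
        rw [← Finset.sum_coe_sort]
        refine (frac_mono ?_).trans (frac_iUnion_le fun c : t => hit T k c \ hit S k c)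
        rintro j ⟨φ, hφ, hj⟩
        obtain ⟨c, hc, hjc⟩ := Set.mem_iUnion₂.1 (ht (Set.mem_univ (φ k j)))
        refine Set.mem_iUnion.2 ⟨⟨c, hc⟩, ⟨φ, hφ, hjc⟩, ?_⟩
        rintro ⟨ψ, hψ, h⟩
        have := hj ψ hψ
        have := dist_triangle_right (φ k j) (ψ k j) c
        rw [Metric.mem_ball] at hjc
        linarith
      have := Finset.sum_le_sum hsplit
      rw [Finset.sum_add_distrib] at this
      push_cast
      linarith
  obtain ⟨n, hn⟩ := exists_nat_gt ((t.card : ℝ) / ε)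
  obtain ⟨S, -, -, -, hS⟩ := key n
  obtain ⟨k, hk⟩ := hS.exists
  have : ∑ c ∈ t, frac (hit S k c) ≤ t.card := by
    simpa using Finset.sum_le_card_nsmul t _ 1 fun c _ => frac_le_one (s := hit S k c)
  rw [div_lt_iff₀ hε] at hn
  linarith

end absorbing

/-! ### Almost-subgroups in the Hausdorff metric -/

section sub

variable {X : Type*} [Group X] [MetricSpace X] [CompactSpace X]

theorem dist_closedSubgroup (H K : ClosedSubgroup X) :
    dist H K = Metric.hausdorffDist (H : Set X) K := rfl

theorem hausdorffEDist_ne_top_of_nonemptyCompacts {X : Type*} [MetricSpace X]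
    (A B : TopologicalSpace.NonemptyCompacts X) :
    Metric.hausdorffEDist (A : Set X) B ≠ ⊤ :=
  Metric.hausdorffEDist_ne_top_of_nonempty_of_bounded A.nonempty B.nonempty
    A.isCompact.isBounded B.isCompact.isBounded

theorem exists_dist_lt_of_dist_lt {H K : ClosedSubgroup X} {r : ℝ} (h : dist H K < r) {x : X}
    (hx : x ∈ H) : ∃ y ∈ K, dist x y < r :=
  Metric.exists_dist_lt_of_hausdorffDist_lt (s := (H : Set X)) (t := K) hx h
    (hausdorffEDist_ne_top_of_nonemptyCompacts (toNonemptyCompacts H) (toNonemptyCompacts K))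

theorem dist_closedSubgroup_le {H K : ClosedSubgroup X} {r : ℝ} (hr : 0 ≤ r)
    (h₁ : ∀ x ∈ H, ∃ y ∈ K, dist x y ≤ r) (h₂ : ∀ x ∈ K, ∃ y ∈ H, dist x y ≤ r) :
    dist H K ≤ r :=
  Metric.hausdorffDist_le_of_mem_dist hr h₁ h₂

variable [IsTopologicalGroup X]

/-- A compact subset of a compact group that is almost closed under division is close to a closed
subgroup. -/
theorem exists_closedSubgroup_dist_lt {ε : ℝ} (hε : 0 < ε) :
    ∃ δ > 0, ∀ A : TopologicalSpace.NonemptyCompacts X,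
      (∀ a ∈ A, ∀ b ∈ A, ∃ c ∈ A, dist (a / b) c < δ) →
        ∃ H : ClosedSubgroup X, dist A (toNonemptyCompacts H) < ε := by
  by_contra! hcon
  choose A hA hfar using fun n : ℕ => hcon (1 / ((n : ℝ) + 1)) Nat.one_div_pos_of_nat
  -- A Hausdorff limit of counterexamples with defect tending to zero is exactly closed under
  -- division, hence a subgroup.
  obtain ⟨B, m, hm, hB⟩ := CompactSpace.tendsto_subseq A
  have hu : UniformContinuous fun p : X × X => p.1 / p.2 :=
    CompactSpace.uniformContinuous_of_continuous continuous_div'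
  have hdiv : ∀ a ∈ B, ∀ b ∈ B, a / b ∈ B := by
    intro a ha b hb
    have hcl : IsClosed (B : Set X) := B.isCompact.isClosed
    change a / b ∈ (B : Set X)
    rw [← hcl.closure_eq, Metric.mem_closure_iff]
    intro η hη
    obtain ⟨δ, hδ, h⟩ := Metric.uniformContinuous_iff.1 hu (η / 3) (by positivity)
    have e1 := Metric.tendsto_nhds.1 hB (min δ (η / 3)) (by positivity)
    have e2 : ∀ᶠ n : ℕ in atTop, 1 / ((m n : ℝ) + 1) < η / 3 :=
      ((tendsto_one_div_add_atTop_nhds_zero_nat (𝕜 := ℝ)).comp hm.tendsto_atTop).eventually_lt_const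
        (by positivity)
    obtain ⟨n, h1, h2⟩ := (e1.and e2).exists
    have hfin := hausdorffEDist_ne_top_of_nonemptyCompacts (A (m n)) B
    obtain ⟨a', ha', haa⟩ := Metric.exists_dist_lt_of_hausdorffDist_lt' ha h1 hfin
    obtain ⟨b', hb', hbb⟩ := Metric.exists_dist_lt_of_hausdorffDist_lt' hb h1 hfin
    obtain ⟨c', hc', hcc⟩ := hA (m n) a' ha' b' hb'
    obtain ⟨c, hc, hcd⟩ := Metric.exists_dist_lt_of_hausdorffDist_lt hc' h1 hfin
    refine ⟨c, hc, ?_⟩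
    have h3 : dist (a' / b') (a / b) < η / 3 := h (a := (a', b')) (b := (a, b)) (by
      simpa [Prod.dist_eq] using ⟨haa.trans_le (min_le_left _ _), hbb.trans_le (min_le_left _ _)⟩)
    rw [dist_comm] at h3
    have h4 := dist_triangle4 (a / b) (a' / b') c' c
    have h5 := hcd.trans_le (min_le_right _ _)
    linarith
  let H : ClosedSubgroup X :=
    { Subgroup.ofDiv (B : Set X) B.nonempty (fun a ha b hb => by
        simpa [div_eq_mul_inv] using hdiv a ha b hb) with
      isClosed' := B.isCompact.isClosed }
  have hH : toNonemptyCompacts H = B := SetLike.coe_injective rfl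
  obtain ⟨n, hn⟩ := (Metric.tendsto_nhds.1 hB ε hε).exists
  exact absurd hn (not_lt.2 (hH ▸ hfar (m n) H))

end sub

end SoficMicrostates

namespace SoficMicrostates

/-! ### The closed-subgroup hull of a group of sequences -/

section limits

variable {X : Type*} [Group X] [MetricSpace X] [CompactSpace X] [IsTopologicalGroup X]
  {d : ℕ → ℕ} [∀ k, NeZero (d k)] {ω : Ultrafilter ℕ}

/-- Sequences of maps into a metric space are complete for convergence in measure along a free
ultrafilter. -/
theorem exists_limit_in_measure {Z : Type*} [PseudoMetricSpace Z] (hω : IsFree ω)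
    (f : ∀ _ k : ℕ, Fin (d k) → Z) (e : ℕ → ℝ)
    (h : ∀ m n, m ≤ n → ∀ᶠ k in ω, frac {j | e m ≤ dist (f m k j) (f n k j)} < e m) :
    ∃ g : ∀ k, Fin (d k) → Z, ∀ m, ∀ᶠ k in ω, frac {j | e m ≤ dist (f m k j) (g k j)} < e m := by
  obtain ⟨N, hN, hdiag⟩ := exists_diagonal hω
    (P := fun n k => ∀ m ∈ Set.Iic n, frac {j | e m ≤ dist (f m k j) (f n k j)} < e m)
    (fun n => (eventually_all_finite (Set.finite_Iic n)).2 fun m hm => h m n hm)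
  refine ⟨fun k => f (N k) k, fun m => ?_⟩
  filter_upwards [hN m, hdiag] with k h1 h2
  exact h2 m h1

/-- The pairwise quotients of an absorbing finite set `S ⊆ M` lie in `M`, so `S` absorbs them. At
most coordinates the values of `S` are thus almost closed under division and
`exists_closedSubgroup_dist_lt` applies. -/
theorem exists_closedSubgroup_approx (M : Subgroup (∀ k, Fin (d k) → X)) (ω : Ultrafilter ℕ)
    {ε : ℝ} (hε : 0 < ε) :
    ∃ (S : Set (∀ k, Fin (d k) → X)) (H : ∀ k, Fin (d k) → ClosedSubgroup X),
      S.Finite ∧ S ⊆ M ∧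
      (∀ T : Set (∀ k, Fin (d k) → X), T.Finite → T ⊆ M → ∀ᶠ k in ω,
        frac {j | ¬ ∀ φ ∈ T, ∃ y ∈ H k j, dist (φ k j) y < ε} < ε) ∧
      ∀ᶠ k in ω, frac {j | ¬ ∀ y ∈ H k j, ∃ ψ ∈ S, dist y (ψ k j) < ε} < ε := by
  classical
  obtain ⟨δ, hδ, hlem⟩ := exists_closedSubgroup_dist_lt (X := X) (half_pos hε)
  have hδ' : 0 < min δ (ε / 2) := by positivity
  obtain ⟨S, hSf, hSM, h1, hS⟩ := exists_finite_absorbing (M : Set (∀ k, Fin (d k) → X))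
    (φ₀ := 1) (one_mem M) ω hδ'
  let A (k : ℕ) (j : Fin (d k)) : TopologicalSpace.NonemptyCompacts X :=
    ⟨⟨(fun φ => φ k j) '' S, (hSf.image _).isCompact⟩, Set.Nonempty.image _ ⟨1, h1⟩⟩
  have hA : ∀ k j x, x ∈ A k j ↔ ∃ φ ∈ S, φ k j = x := fun k j x => Iff.rfl
  have hH : ∀ k j, ∃ H : ClosedSubgroup X, (∃ K : ClosedSubgroup X,
      dist (A k j) (toNonemptyCompacts K) < ε / 2) →
        dist (A k j) (toNonemptyCompacts H) < ε / 2 := by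
    intro k j
    by_cases h : ∃ K : ClosedSubgroup X, dist (A k j) (toNonemptyCompacts K) < ε / 2
    · obtain ⟨K, hK⟩ := h
      exact ⟨K, fun _ => hK⟩
    -- An arbitrary default at the exceptional coordinates.
    · exact ⟨wholeGroup X, fun h' => absurd h' h⟩
  choose H hH using hH
  have hdiv := hS (Set.image2 (· / ·) S S) (hSf.image2 _ hSf) (by
    rintro _ ⟨a, ha, b, hb, rfl⟩
    exact M.div_mem (hSM ha) (hSM hb))
  have hclose : ∀ k j, ε / 2 ≤ dist (A k j) (toNonemptyCompacts (H k j)) →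
      ∃ φ ∈ Set.image2 (· / ·) S S, ∀ ψ ∈ S, min δ (ε / 2) ≤ dist (φ k j) (ψ k j) := by
    intro k j hkj
    by_contra! hc
    refine absurd (hH k j (hlem _ ?_)) (not_lt.2 hkj)
    rintro _ ⟨a, ha, rfl⟩ _ ⟨b, hb, rfl⟩
    obtain ⟨ψ, hψ, h⟩ := hc (a / b) ⟨a, ha, b, hb, rfl⟩
    exact ⟨ψ k j, ⟨ψ, hψ, rfl⟩, h.trans_le (min_le_left _ _)⟩
  refine ⟨S, H, hSf, hSM, fun T hTf hTM => ?_, ?_⟩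
  · filter_upwards [hdiv, hS T hTf hTM] with k hk1 hk2
    refine (frac_le_add (u := {j | _}) fun j hj => ?_).trans_lt
      ((add_lt_add hk1 hk2).trans_le (b := min δ (ε / 2) + min δ (ε / 2)) ?_)
    · by_contra hc
      rw [Set.mem_union, not_or] at hc
      refine hj fun φ hφ => ?_
      have h2 : dist (A k j) (toNonemptyCompacts (H k j)) < ε / 2 :=
        not_le.1 fun h => hc.1 (hclose k j h)
      have h3 : ∃ ψ ∈ S, dist (φ k j) (ψ k j) < min δ (ε / 2) := by
        by_contra! h
        exact hc.2 ⟨φ, hφ, h⟩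
      obtain ⟨ψ, hψ, h3⟩ := h3
      obtain ⟨y, hy, hyd⟩ := Metric.exists_dist_lt_of_hausdorffDist_lt
        (s := (A k j : Set X)) (x := ψ k j) ⟨ψ, hψ, rfl⟩ h2
        (hausdorffEDist_ne_top_of_nonemptyCompacts _ _)
      refine ⟨y, hy, (dist_triangle _ (ψ k j) _).trans_lt ?_⟩
      have := h3.trans_le (min_le_right _ _)
      linarith
    · have := min_le_right δ (ε / 2)
      linarith
  · filter_upwards [hdiv] with k hk
    refine (frac_mono fun j hj => ?_).trans_lt
      (hk.trans_le ((min_le_right _ _).trans (half_le_self hε.le)))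
    refine hclose k j ?_
    by_contra! h2
    refine hj fun y hy => ?_
    obtain ⟨_, ⟨ψ, hψ, rfl⟩, hd⟩ := Metric.exists_dist_lt_of_hausdorffDist_lt'
      (s := (A k j : Set X)) (t := (toNonemptyCompacts (H k j) : Set X)) hy h2 (hausdorffEDist_ne_top_of_nonemptyCompacts _ _)
    rw [dist_comm] at hd
    exact ⟨ψ, hψ, hd.trans (half_lt_self hε)⟩

/-- A group of sequences of maps into a compact group has an essential closed-subgroup-valued
hull, which is approximated by finite subfamilies. -/
theorem exists_closedSubgroup_hull (hω : IsFree ω) (M : Subgroup (∀ k, Fin (d k) → X)) :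
    ∃ Y : ∀ k, Fin (d k) → ClosedSubgroup X, ∀ ε : ℝ, 0 < ε →
      (∀ φ ∈ M, ∀ᶠ k in ω, frac {j | ¬ ∃ y ∈ Y k j, dist (φ k j) y < ε} < ε) ∧
      ∃ S : Set (∀ k, Fin (d k) → X), S.Finite ∧ S ⊆ M ∧
        ∀ᶠ k in ω, frac {j | ¬ ∀ y ∈ Y k j, ∃ ψ ∈ S, dist y (ψ k j) < ε} < ε := by
  let e (m : ℕ) : ℝ := 1 / ((m : ℝ) + 1)
  have he : ∀ m, 0 < e m := fun m => Nat.one_div_pos_of_nat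
  have hanti : ∀ m n, m ≤ n → e n ≤ e m := fun m n h => Nat.one_div_le_one_div h
  choose S H hSf hSM hHi hHs using fun m =>
    exists_closedSubgroup_approx M ω (show 0 < e m / 4 by have := he m; positivity)
  have hcauchy : ∀ m n, m ≤ n →
      ∀ᶠ k in ω, frac {j | e m ≤ dist (H m k j) (H n k j)} < e m := by
    intro m n hmn
    -- Each subgroup is covered by its own finite family, which the other subgroup absorbs. The four
    -- exceptional sets account for the scale `e m / 4`.
    filter_upwards [hHs m, hHs n, hHi m (S n) (hSf n) (hSM n), hHi n (S m) (hSf m) (hSM m)]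
      with k h1 h2 h3 h4
    have hmn' := hanti m n hmn
    have hem := he m
    have hen := he n
    refine (frac_le_add (u := {j | _}) ?_).trans_lt ((add_lt_add
      ((frac_union_le _ _).trans_lt (add_lt_add h1 h2))
      ((frac_union_le _ _).trans_lt (add_lt_add h3 h4))).trans_le ?_)
    · intro j hj
      by_contra hc
      simp only [Set.mem_union, Set.mem_ofPred_eq, not_or, not_not] at hc
      obtain ⟨⟨c1, c2⟩, c3, c4⟩ := hc
      refine absurd (dist_closedSubgroup_le (r := e m / 2) (by positivity) ?_ ?_)
        (not_le.2 ((half_lt_self hem).trans_le hj))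
      · intro x hx
        obtain ⟨ψ, hψ, hd⟩ := c1 x hx
        obtain ⟨y, hy, hd'⟩ := c4 ψ hψ
        exact ⟨y, hy, (dist_triangle _ (ψ k j) _).trans (by linarith)⟩
      · intro x hx
        obtain ⟨ψ, hψ, hd⟩ := c2 x hx
        obtain ⟨y, hy, hd'⟩ := c3 ψ hψ
        exact ⟨y, hy, (dist_triangle _ (ψ k j) _).trans (by linarith)⟩
    · linarith
  obtain ⟨Y, hY⟩ := exists_limit_in_measure hω H e hcauchy
  refine ⟨Y, fun ε hε => ?_⟩
  obtain ⟨m, hm⟩ := exists_nat_one_div_lt (half_pos hε)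
  change e m < ε / 2 at hm
  have hem := he m
  refine ⟨fun φ hφ => ?_, S m, hSf m, hSM m, ?_⟩
  · filter_upwards [hHi m {φ} (Set.finite_singleton φ) (by simpa using hφ), hY m] with k h1 h2
    refine (frac_le_add (u := {j | _}) fun j hj => ?_).trans_lt
      ((add_lt_add h1 h2).trans_le (b := e m / 4 + e m) (by linarith))
    by_contra hc
    simp only [Set.mem_union, Set.mem_ofPred_eq, not_or, not_not, not_le, Set.mem_singleton_iff,
      forall_eq] at hc
    obtain ⟨x, hx, hd⟩ := hc.1
    obtain ⟨y, hy, hd'⟩ := exists_dist_lt_of_dist_lt hc.2 hx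
    exact hj ⟨y, hy, (dist_triangle _ x _).trans_lt (by linarith)⟩
  · filter_upwards [hHs m, hY m] with k h1 h2
    refine (frac_le_add (u := {j | _}) fun j hj => ?_).trans_lt
      ((add_lt_add h1 h2).trans_le (b := e m / 4 + e m) (by linarith))
    by_contra hc
    simp only [Set.mem_union, Set.mem_ofPred_eq, not_or, not_not, not_le] at hc
    refine hj fun y hy => ?_
    rw [dist_comm] at hc
    obtain ⟨x, hx, hd'⟩ := exists_dist_lt_of_dist_lt hc.2 hy
    obtain ⟨ψ, hψ, hd⟩ := hc.1 x hx
    exact ⟨ψ, hψ, (dist_triangle _ x _).trans_lt (by linarith)⟩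

end limits

end SoficMicrostates

namespace SoficMicrostates

universe u v w

/-! ### Random words and equidistribution -/

section walk

/-- One step of averaging along left translations by a finite family of group elements. -/
def walkAvg {ι X : Type*} [Fintype ι] [Mul X] (s : ι → X) (f : X → ℝ) (x : X) : ℝ :=
  (∑ t, f (s t * x)) / Fintype.card ι

/-- The weights and words are fixed in `M` before the homomorphism `e` is chosen; later `e` is
evaluation at a coordinate, and one law must serve all coordinates. -/
theorem exists_iterate_walkAvg {ι : Type u} {M : Type v} [Fintype ι] [Nonempty ι] [Monoid M] (S : ι → M)
    (l : ℕ) :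
    ∃ (I : Type u) (_ : Fintype I) (p : I → ℝ) (w : I → M), (∀ i, 0 ≤ p i) ∧ ∑ i, p i = 1 ∧
      ∀ {X : Type w} [Monoid X] (e : M →* X) (f : X → ℝ) (x : X),
        ∑ i, p i * f (e (w i) * x) = (walkAvg fun t => e (S t))^[l] f x := by
  have hι : (Fintype.card ι : ℝ) ≠ 0 := by exact_mod_cast Fintype.card_ne_zero
  induction l with
  | zero => exact ⟨PUnit, inferInstance, fun _ => 1, fun _ => 1, by simp, by simp, by simp⟩
  | succ l ih =>
    obtain ⟨I, _, p, w, hp, hp1, h⟩ := ih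
    refine ⟨ι × I, inferInstance, fun i => p i.2 / Fintype.card ι, fun i => w i.2 * S i.1,
      fun i => div_nonneg (hp _) (Nat.cast_nonneg _), ?_, fun e f x => ?_⟩
    · simp only [Fintype.sum_prod_type, ← Finset.sum_div, hp1]
      simp [hι]
    · rw [Function.iterate_succ_apply', walkAvg, Fintype.sum_prod_type, Finset.sum_div]
      refine Finset.sum_congr rfl fun t _ => ?_
      rw [← h, Finset.sum_div]
      refine Finset.sum_congr rfl fun i _ => ?_
      rw [map_mul, mul_assoc]
      ring

theorem exists_cesaro_walkAvg {ι : Type u} {M : Type v} [Fintype ι] [Nonempty ι] [Monoid M] (S : ι → M)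
    {N : ℕ} (hN : N ≠ 0) :
    ∃ (I : Type u) (_ : Fintype I) (p : I → ℝ) (w : I → M), (∀ i, 0 ≤ p i) ∧ ∑ i, p i = 1 ∧
      ∀ {X : Type w} [Monoid X] (e : M →* X) (f : X → ℝ) (x : X),
        ∑ i, p i * f (e (w i) * x) =
          (∑ l : Fin N, (walkAvg fun t => e (S t))^[l] f x) / N := by
  have hN' : (N : ℝ) ≠ 0 := by exact_mod_cast hN
  choose I hI p w hp hp1 h using exists_iterate_walkAvg S
  refine ⟨Σ l : Fin N, I l, inferInstance, fun i => p i.1 i.2 / N, fun i => w i.1 i.2,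
    fun i => div_nonneg (hp _ _) (Nat.cast_nonneg _), ?_, fun e f x => ?_⟩
  · simp only [Fintype.sum_sigma, ← Finset.sum_div, hp1]
    simp [hN']
  · rw [Fintype.sum_sigma, Finset.sum_div]
    refine Finset.sum_congr rfl fun l _ => ?_
    rw [← h, Finset.sum_div]
    refine Finset.sum_congr rfl fun i _ => ?_
    ring

theorem abs_iterate_walkAvg_le {ι X : Type*} [Fintype ι] [Nonempty ι] [Mul X] (s : ι → X)
    {f : X → ℝ} {C : ℝ} (hf : ∀ x, |f x| ≤ C) (l : ℕ) (x : X) : |(walkAvg s)^[l] f x| ≤ C := by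
  have hι : (0 : ℝ) < Fintype.card ι := by exact_mod_cast Fintype.card_pos
  induction l generalizing x with
  | zero => exact hf x
  | succ l ih =>
    rw [Function.iterate_succ_apply', walkAvg, abs_div, abs_of_pos hι, div_le_iff₀ hι]
    refine (Finset.abs_sum_le_sum_abs _ _).trans ?_
    refine (Finset.sum_le_card_nsmul _ _ C fun t _ => ih _).trans ?_
    simp [mul_comm]

/-- The difference telescopes to the first term minus the `N`-th iterate, divided by `N`. -/
theorem cesaro_sub_walkAvg {ι X : Type*} [Fintype ι] [Nonempty ι] [Mul X] (s : ι → X)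
    {f : X → ℝ} (hf : ∀ x, |f x| ≤ 1) (N : ℕ) (x : X) :
    (∑ l : Fin N, (walkAvg s)^[l] f x) / N -
      walkAvg s (fun x => (∑ l : Fin N, (walkAvg s)^[l] f x) / N) x ≤ 2 / N := by
  have h1 : walkAvg s (fun x => (∑ l : Fin N, (walkAvg s)^[l] f x) / N) x =
      (∑ l : Fin N, (walkAvg s)^[l + 1] f x) / N := by
    simp only [Function.iterate_succ_apply']
    simp only [walkAvg, ← Finset.sum_div]
    rw [Finset.sum_comm, div_right_comm]
  have h2 := Finset.sum_range_sub' (fun l => (walkAvg s)^[l] f x) N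
  rw [Finset.sum_sub_distrib] at h2
  rw [h1, ← sub_div, Fin.sum_univ_eq_sum_range (fun l => (walkAvg s)^[l] f x),
    Fin.sum_univ_eq_sum_range (fun l => (walkAvg s)^[l + 1] f x), h2]
  refine div_le_div_of_nonneg_right ?_ (Nat.cast_nonneg _)
  have h3 := (abs_le.1 (abs_iterate_walkAvg_le s hf 0 x)).2
  have h4 := (abs_le.1 (abs_iterate_walkAvg_le s hf N x)).1
  linarith

end walk

section haar

variable {X : Type*} [Group X] [MetricSpace X] [CompactSpace X]

/-- A function that is almost superharmonic for a walk with dense steps is almost constant. -/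
theorem sub_le_of_almost_harmonic {ι : Type*} [Fintype ι] [Nonempty ι] {s : ι → X}
    {F : X → ℝ} (hF : Continuous F) {c ε η : ℝ}
    (hc : ∀ x, F x - walkAvg s F x ≤ c) (hε : ∀ x y z, dist y z < η → |F (y * x) - F (z * x)| ≤ ε)
    (hs : ∀ x, ∃ t, dist x (s t) < η) (x y : X) :
    F x - F y ≤ Fintype.card ι * c + ε := by
  obtain ⟨m, -, hm⟩ := isCompact_univ.exists_isMaxOn (Set.univ_nonempty (α := X)) hF.continuousOn
  have hm : ∀ z, F z ≤ F m := fun z => hm (Set.mem_univ z)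
  have hι : (0 : ℝ) < Fintype.card ι := by exact_mod_cast Fintype.card_pos
  -- The step is chosen so that `s t * m` is near `y`. At the maximum `m` all differences `F m - F
  -- (s t * m)` are nonnegative, so each is bounded by their sum.
  obtain ⟨t, ht⟩ := hs (y * m⁻¹)
  have h1 := (abs_le.1 (hε m _ _ ht)).1
  rw [inv_mul_cancel_right] at h1
  have h2 : F m - F (s t * m) ≤ Fintype.card ι * c := by
    have h3 : ∑ t, (F m - F (s t * m)) ≤ Fintype.card ι * c := by
      have h4 := hc m
      rw [walkAvg, sub_le_iff_le_add, ← sub_le_iff_le_add', le_div_iff₀ hι] at h4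
      rw [Finset.sum_sub_distrib]
      simp only [Finset.sum_const, Finset.card_univ, nsmul_eq_mul]
      linarith
    exact (Finset.single_le_sum (f := fun t => F m - F (s t * m))
      (fun t _ => sub_nonneg.2 (hm _)) (Finset.mem_univ t)).trans h3
  have := hm x
  linarith

variable [IsTopologicalGroup X] [MeasurableSpace X] [BorelSpace X]

/-- Words in a sufficiently dense finite family, weighted independently of the family, nearly
equidistribute with respect to Haar measure. -/
theorem exists_equidistributing_words {ε : ℝ} (hε : 0 < ε) :
    ∃ η > 0, ∀ {ι : Type u} {M : Type v} [Fintype ι] [Nonempty ι] [Group M] (S : ι → M),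
      ∃ (I : Type u) (_ : Fintype I) (p : I → ℝ) (w : I → M), (∀ i, 0 ≤ p i) ∧ ∑ i, p i = 1 ∧
        ∀ e : M →* X, (∀ x, ∃ t, dist x (e (S t)) < η) → ∀ f : X → ℝ, LipschitzWith 1 f →
          (∀ x, |f x| ≤ 1) →
            |∑ i, p i * f (e (w i)) - ∫ x, f x ∂(haarProb X : Measure X)| ≤ ε := by
  have hu : UniformContinuous fun q : X × X × X => q.1 * q.2.1 * q.2.2 :=
    CompactSpace.uniformContinuous_of_continuous (by fun_prop)
  obtain ⟨η, hη, hu⟩ := Metric.uniformContinuous_iff.1 hu (ε / 2) (half_pos hε)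
  refine ⟨η, hη, fun {ι M} _ _ _ S => ?_⟩
  have hι : (0 : ℝ) < Fintype.card ι := by exact_mod_cast Fintype.card_pos
  -- `η` depends on `ε` alone; `N` also depends on the number of generators, so that the defect `2 /
  -- N` times that number is at most `ε / 2`.
  obtain ⟨N, hN⟩ := exists_nat_gt (Fintype.card ι * 2 / (ε / 2))
  have hN0 : (0 : ℝ) < N := lt_of_le_of_lt (by positivity) hN
  obtain ⟨I, hI, p, w, hp, hp1, h⟩ := exists_cesaro_walkAvg S (N := N) (by
    rintro rfl; simp at hN0)
  refine ⟨I, hI, p, w, hp, hp1, fun e hdense f hf hf1 => ?_⟩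
  let F (x : X) : ℝ := ∑ i, p i * f (e (w i) * x)
  have hFeq : F = fun x => (∑ l : Fin N, (walkAvg fun t => e (S t))^[l] f x) / N :=
    funext fun x => h e f x
  have hfc := hf.continuous
  have hF : Continuous F := by fun_prop
  have hosc := sub_le_of_almost_harmonic (s := fun t => e (S t)) hF (c := 2 / N) (ε := ε / 2)
    (η := η) (fun x => by rw [hFeq]; exact cesaro_sub_walkAvg _ hf1 N x) (fun x y z hyz => by
      have hle : ∀ i, |f (e (w i) * (y * x)) - f (e (w i) * (z * x))| ≤ ε / 2 := fun i => by
        have h1 := hf.dist_le_mul (e (w i) * (y * x)) (e (w i) * (z * x))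
        have h2 := hu (a := (e (w i), y, x)) (b := (e (w i), z, x))
          (by simpa [Prod.dist_eq, hη] using hyz)
        simp only [mul_assoc] at h2
        rw [Real.dist_eq, NNReal.coe_one, one_mul] at h1
        exact h1.trans h2.le
      simp only [F]
      rw [← Finset.sum_sub_distrib]
      refine (Finset.abs_sum_le_sum_abs _ _).trans ?_
      calc ∑ i, |p i * f (e (w i) * (y * x)) - p i * f (e (w i) * (z * x))|
          ≤ ∑ i, p i * (ε / 2) := Finset.sum_le_sum fun i _ => by
            rw [← mul_sub, abs_mul, abs_of_nonneg (hp i)]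
            exact mul_le_mul_of_nonneg_left (hle i) (hp i)
        _ = ε / 2 := by rw [← Finset.sum_mul, hp1, one_mul]) hdense
  have hsmall : Fintype.card ι * (2 / N) + ε / 2 ≤ ε := by
    rw [div_lt_iff₀ (half_pos hε)] at hN
    have : Fintype.card ι * (2 / N) ≤ ε / 2 := by
      rw [← mul_div_assoc, div_le_iff₀ hN0]
      linarith
    linarith
  have hint : ∀ φ : X → ℝ, Continuous φ → Integrable φ (haarProb X : Measure X) := fun φ hφ =>
    hφ.integrable_of_hasCompactSupport (HasCompactSupport.of_compactSpace φ)
  -- `F` averages left translates of `f`, so its Haar mean is that of `f`; as `F` is almost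
  -- constant, `F 1` is near that mean.
  have hinv : ∫ x, F x ∂(haarProb X : Measure X) = ∫ x, f x ∂(haarProb X : Measure X) := by
    have : (haarProb X : Measure X).IsMulLeftInvariant :=
      inferInstanceAs (Measure.haarMeasure (⊤ : TopologicalSpace.PositiveCompacts X)).IsMulLeftInvariant
    simp only [F]
    rw [integral_finsetSum _ fun i _ => hint _ (by fun_prop)]
    simp only [integral_const_mul, integral_mul_left_eq_self]
    rw [← Finset.sum_mul, hp1, one_mul]
  have h1 : ∑ i, p i * f (e (w i)) = F 1 := by simp [F]
  rw [h1, ← hinv]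
  have h2 : F 1 - ∫ x, F x ∂(haarProb X : Measure X) =
      ∫ x, (F 1 - F x) ∂(haarProb X : Measure X) := by
    rw [integral_sub (integrable_const _) (hint F hF)]
    simp
  rw [h2, ← Real.norm_eq_abs]
  refine (norm_integral_le_of_norm_le_const (C := ε) (Eventually.of_forall fun x => ?_)).trans ?_
  · rw [Real.norm_eq_abs, abs_le]
    have := hosc 1 x
    have := hosc x 1
    constructor <;> linarith
  · simp

end haar

end SoficMicrostates

namespace SoficMicrostates

/-! ### Averages, empirical distributions and discrete measures -/

section frac

variable {d : ℕ} [NeZero d]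

theorem integral_unif (f : Fin d → ℝ) :
    ∫ j, f j ∂(unif d : Measure (Fin d)) = ∑ j, frac {j} * f j := by
  rw [integral_fintype (Integrable.of_finite)]
  simp [frac_eq_real]

theorem frac_eq_sum_indicator (s : Set (Fin d)) :
    frac s = ∑ j, frac {j} * s.indicator 1 j := by
  rw [← integral_unif, integral_indicator_one s.toFinite.measurableSet, frac_eq_real]

theorem measurable_frac {Z : Type*} [MeasurableSpace Z] {p : Z → Fin d → Prop}
    (hp : ∀ j, MeasurableSet {z | p z j}) : Measurable fun z => frac {j | p z j} := by
  have h : (fun z => frac {j | p z j}) =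
      fun z => ∑ j, frac {j} * {z | p z j}.indicator (fun _ => (1 : ℝ)) z :=
    funext fun z => frac_eq_sum_indicator _
  rw [h]
  refine Finset.measurable_fun_sum _ fun j _ => Measurable.const_mul ?_ _
  exact (measurable_const (a := (1 : ℝ))).indicator (hp j)

theorem integrable_indicator_one_of_finite {Z : Type*} [MeasurableSpace Z] {μ : Measure Z}
    [IsFiniteMeasure μ] {s : Set Z} (hs : MeasurableSet s) :
    Integrable (s.indicator (1 : Z → ℝ)) μ :=
  (integrable_const (1 : ℝ)).indicator hs

theorem mul_frac_le_integral {f : Fin d → ℝ} (hf : ∀ j, 0 ≤ f j) (ε : ℝ) :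
    ε * frac {j | ε ≤ f j} ≤ ∫ j, f j ∂(unif d : Measure (Fin d)) := by
  rw [frac_eq_real]
  exact mul_meas_ge_le_integral_of_nonneg (Eventually.of_forall hf) Integrable.of_finite ε

end frac

section empirical

variable {X : Type*} [Group X] [MetricSpace X] [CompactSpace X]

theorem integral_empirical {d : ℕ} [NeZero d] (Y : Fin d → ClosedSubgroup X)
    {f : ClosedSubgroup X → ℝ} (hf : Continuous f) :
    ∫ H, f H ∂(empirical Y : Measure (ClosedSubgroup X)) =
      ∫ j, f (Y j) ∂(unif d : Measure (Fin d)) := by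
  rw [empirical, ProbabilityMeasure.toMeasure_map,
    integral_map (measurable_of_finite Y).aemeasurable hf.measurable.aestronglyMeasurable]

/-- Convergence of empirical distributions to a point mass is convergence in measure. -/
theorem tendsto_empirical_iff {ι : Type*} {l : Filter ι} {d : ι → ℕ} [∀ k, NeZero (d k)]
    {Y : ∀ k, Fin (d k) → ClosedSubgroup X} {H : ClosedSubgroup X} :
    Tendsto (fun k => empirical (Y k)) l (𝓝 (diracProba H)) ↔
      ∀ ε : ℝ, 0 < ε → ∀ᶠ k in l, frac {j | ε ≤ dist (Y k j) H} < ε := by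
  have hdirac : ∀ f : BoundedContinuousFunction (ClosedSubgroup X) ℝ,
      ∫ K, f K ∂(diracProba H : Measure (ClosedSubgroup X)) = f H := fun f =>
    integral_dirac' _ _ f.continuous.stronglyMeasurable
  rw [ProbabilityMeasure.tendsto_iff_forall_integral_tendsto]
  simp only [hdirac]
  constructor
  · intro h ε hε
    let f : BoundedContinuousFunction (ClosedSubgroup X) ℝ :=
      BoundedContinuousFunction.ofNormedAddCommGroup (fun K => min 1 (dist K H)) (by fun_prop) 1
        fun K => by
          rw [Real.norm_eq_abs, abs_of_nonneg (le_min zero_le_one dist_nonneg)]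
          exact min_le_left _ _
    have hf : ∀ K, f K = min 1 (dist K H) := fun K => rfl
    have hε' : 0 < min 1 ε := by positivity
    -- Markov's inequality at level `min 1 ε` costs one factor, hence the square.
    have h1 := (h f).eventually_lt_const (u := min 1 ε * min 1 ε)
      (by rw [hf, dist_self]; simpa using mul_pos hε' hε')
    filter_upwards [h1] with k hk
    rw [integral_empirical _ f.continuous] at hk
    have h2 := mul_frac_le_integral (f := fun j => f (Y k j))
      (fun j => le_min zero_le_one dist_nonneg) (min 1 ε)
    have h3 := lt_of_mul_lt_mul_left (h2.trans_lt hk) hε'.le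
    refine (frac_mono fun j hj => ?_).trans_lt (h3.trans_le (min_le_right _ _))
    exact min_le_min_left 1 (show ε ≤ dist (Y k j) H from hj)
  · intro h f
    rw [Metric.tendsto_nhds]
    intro η hη
    obtain ⟨δ, hδ, hfδ⟩ := Metric.continuousAt_iff.1 (f.continuous.continuousAt (x := H)) (η / 2)
      (half_pos hη)
    have hC : 0 < 4 * (‖f‖ + 1) := by positivity
    filter_upwards [h (min δ (η / (4 * (‖f‖ + 1)))) (by positivity)] with k hk
    rw [integral_empirical _ f.continuous, Real.dist_eq]
    have h1 : ∫ j, f (Y k j) ∂(unif (d k) : Measure (Fin (d k))) - f H =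
        ∫ j, (f (Y k j) - f H) ∂(unif (d k) : Measure (Fin (d k))) := by
      rw [integral_sub Integrable.of_finite Integrable.of_finite]
      simp
    have hfrac : frac {j | δ ≤ dist (Y k j) H} < η / (4 * (‖f‖ + 1)) :=
      (frac_mono fun j (hj : δ ≤ dist (Y k j) H) =>
        show _ ≤ dist (Y k j) H from (min_le_left _ _).trans hj).trans_lt (hk.trans_le (min_le_right _ _))
    rw [lt_div_iff₀ hC] at hfrac
    have h2 : ∫ j, (η / 2 + 2 * ‖f‖ * {j | δ ≤ dist (Y k j) H}.indicator 1 j)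
        ∂(unif (d k) : Measure (Fin (d k))) =
        η / 2 + 2 * ‖f‖ * frac {j | δ ≤ dist (Y k j) H} := by
      rw [integral_add Integrable.of_finite Integrable.of_finite, integral_const_mul,
        integral_indicator_one (Set.toFinite _).measurableSet, frac_eq_real]
      simp
    rw [h1]
    refine (abs_integral_le_integral_abs).trans_lt
      ((integral_mono Integrable.of_finite Integrable.of_finite fun j => ?_).trans_lt
        (h2.trans_lt ?_))
    · by_cases hj : δ ≤ dist (Y k j) H
      · rw [Set.indicator_of_mem (show j ∈ {j | δ ≤ dist (Y k j) H} from hj)]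
        have := f.dist_le_two_norm (Y k j) H
        rw [Real.dist_eq] at this
        simp only [Pi.one_apply]
        linarith
      · rw [Set.indicator_of_notMem (show j ∉ {j | δ ≤ dist (Y k j) H} from hj)]
        have := hfδ (not_le.1 hj)
        rw [Real.dist_eq] at this
        simp only [mul_zero, add_zero]
        exact this.le
    · have := frac_nonneg (s := {j | δ ≤ dist (Y k j) H})
      nlinarith [norm_nonneg f]

end empirical

section discrete

/-- The finite combination of point masses at `w i` with weights `p i`. -/
def sumDirac {I Z : Type*} [Fintype I] [MeasurableSpace Z] (p : I → ℝ) (w : I → Z)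
    (hp : ∀ i, 0 ≤ p i) (hp1 : ∑ i, p i = 1) : ProbabilityMeasure Z :=
  ⟨∑ i, ENNReal.ofReal (p i) • Measure.dirac (w i), ⟨by
    simp [← ENNReal.ofReal_sum_of_nonneg fun i _ => hp i, hp1]⟩⟩

variable {I Z : Type*} [Fintype I] [MeasurableSpace Z] {p : I → ℝ} {w : I → Z}
  (hp : ∀ i, 0 ≤ p i) (hp1 : ∑ i, p i = 1)

/-- `A` may be non-measurable, since a Dirac mass at a point of any set gives that set mass one. -/
theorem sumDirac_apply_eq_one {A : Set Z} (hA : ∀ i, w i ∈ A) : sumDirac p w hp hp1 A = 1 := by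
  refine le_antisymm (ProbabilityMeasure.apply_le_one _ _) ?_
  rw [← ENNReal.coe_le_coe, ProbabilityMeasure.ennreal_coeFn_eq_coeFn_toMeasure]
  simp only [sumDirac, ProbabilityMeasure.coe_mk, Measure.coe_finsetSum, Finset.sum_apply,
    Measure.smul_apply, Measure.dirac_apply_of_mem (hA _), smul_eq_mul, mul_one]
  rw [← ENNReal.ofReal_sum_of_nonneg fun i _ => hp i, hp1]
  simp

theorem integral_sumDirac {f : Z → ℝ} (hf : StronglyMeasurable f) :
    ∫ z, f z ∂(sumDirac p w hp hp1 : Measure Z) = ∑ i, p i * f (w i) := by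
  have hint : ∀ i ∈ Finset.univ, Integrable f (ENNReal.ofReal (p i) • Measure.dirac (w i)) :=
    fun i _ => (integrable_dirac' hf (by simp)).smul_measure ENNReal.ofReal_ne_top
  simp only [sumDirac, ProbabilityMeasure.coe_mk]
  rw [integral_finsetSum_measure hint]
  refine Finset.sum_congr rfl fun i _ => ?_
  rw [integral_smul_measure, integral_dirac' _ _ hf, ENNReal.toReal_ofReal (hp i), smul_eq_mul]

end discrete

end SoficMicrostates

namespace SoficMicrostates

universe u

variable {G : Type*} {X : Type u} [Group G] [Group X] [MetricSpace X] [CompactSpace X]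
  [MeasurableSpace X] [MulDistribMulAction G X]
  {d : ℕ → ℕ} [∀ k, NeZero (d k)] {σ : ∀ k, G → Equiv.Perm (Fin (d k))} {ω : Ultrafilter ℕ}

/-! ### Measures on microstates with almost Haar marginals -/

section construction

/-- Integrals of bounded Lipschitz functions define the neighbourhoods of a probability measure. -/
theorem exists_close_subset_nhds {Z : Type*} [PseudoMetricSpace Z] [MeasurableSpace Z]
    [OpensMeasurableSpace Z] {m : ProbabilityMeasure Z} {O : Set (ProbabilityMeasure Z)}
    (hO : O ∈ 𝓝 m) :
    ∃ ε > 0, ∀ ν : ProbabilityMeasure Z, (∀ f : Z → ℝ, LipschitzWith 1 f → (∀ x, |f x| ≤ 1) →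
      |∫ x, f x ∂(ν : Measure Z) - ∫ x, f x ∂(m : Measure Z)| ≤ ε) → ν ∈ O := by
  by_contra! hcon
  choose ν hν hνO using fun n : ℕ => hcon (1 / ((n : ℝ) + 1)) Nat.one_div_pos_of_nat
  have hlim : Tendsto ν atTop (𝓝 m) := by
    rw [tendsto_iff_forall_lipschitz_integral_tendsto]
    rintro f ⟨C, hC⟩ ⟨L, hL⟩
    obtain ⟨x₀⟩ := m.nonempty
    -- Dividing by `D` makes `f` both 1-Lipschitz and bounded by 1; the summand 1 keeps `D`
    -- positive.
    let D : ℝ := 1 + L + C + |f x₀|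
    have hC0 : 0 ≤ C := by simpa using hC x₀ x₀
    have hDpos : 0 < D := by positivity
    have hDL : (L : ℝ) ≤ D := by have := abs_nonneg (f x₀); simp only [D]; linarith
    have hscale : ∀ n, |∫ x, f x ∂(ν n : Measure Z) - ∫ x, f x ∂(m : Measure Z)| ≤
        D * (1 / ((n : ℝ) + 1)) := by
      intro n
      have h := hν n (fun x => D⁻¹ * f x) (LipschitzWith.of_dist_le_mul fun x y => by
        rw [Real.dist_eq, ← mul_sub, abs_mul, abs_of_pos (inv_pos.2 hDpos), NNReal.coe_one, one_mul,
          inv_mul_le_iff₀ hDpos]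
        exact (hL.dist_le_mul x y).trans (mul_le_mul_of_nonneg_right hDL dist_nonneg)) fun x => by
        rw [abs_mul, abs_of_pos (inv_pos.2 hDpos), inv_mul_le_iff₀ hDpos, mul_one]
        have h1 := hC x x₀
        rw [Real.dist_eq] at h1
        have h2 := abs_sub_abs_le_abs_sub (f x) (f x₀)
        have h3 := L.coe_nonneg
        simp only [D]
        linarith
      rwa [integral_const_mul, integral_const_mul, ← mul_sub, abs_mul, abs_of_pos (inv_pos.2 hDpos),
        inv_mul_le_iff₀ hDpos] at h
    rw [tendsto_iff_dist_tendsto_zero]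
    refine squeeze_zero (fun _ => dist_nonneg) hscale ?_
    simpa using (tendsto_one_div_add_atTop_nhds_zero_nat (𝕜 := ℝ)).const_mul D
  obtain ⟨n, hn⟩ := (hlim.eventually_mem hO).exists
  exact hνO n hn

/-- Measures supported on maps satisfying the microstate conditions to increasing accuracy are
asymptotically supported on microstates. -/
theorem asympSupported_of_diagonal {g : ℕ → G} (hg : Function.Surjective g) {N : ℕ → ℕ}
    (hN : ∀ n, ∀ᶠ k in ω, n ≤ N k) {μ : ∀ k, ProbabilityMeasure (Fin (d k) → X)}
    (h : ∀ᶠ k in ω, ∀ i ∈ Set.Iic (N k), μ k {φ | frac {j | 1 / ((N k : ℝ) + 1) ≤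
      dist (g i • φ j) (φ (σ k (g i) j))} < 1 / ((N k : ℝ) + 1)} = 1) :
    AsympSupportedOnMicrostates σ ω μ := by
  intro g₀ U hU hdiag δ hδ
  obtain ⟨i, rfl⟩ := hg g₀
  have hU' : U ∈ uniformity X := by
    rw [← nhdsSet_diagonal_eq_uniformity]
    exact hU.mem_nhdsSet.2 hdiag
  obtain ⟨ε, hε, hUε⟩ := Metric.mem_uniformity_dist.1 hU'
  obtain ⟨n, hn⟩ := exists_nat_one_div_lt (show 0 < min ε δ by positivity)
  refine tendsto_const_nhds.congr' ?_
  filter_upwards [h, hN i, hN n] with k h1 h2 h3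
  refine le_antisymm ((h1 i h2).symm.le.trans (ProbabilityMeasure.apply_mono _ fun φ hφ => ?_))
    (ProbabilityMeasure.apply_le_one _ _)
  have h4 : 1 / ((N k : ℝ) + 1) < min ε δ := (Nat.one_div_le_one_div h3).trans_lt hn
  have h5 : frac {j | (φ (σ k (g i) j), g i • φ j) ∈ U}ᶜ < δ := by
    refine (frac_mono fun j hj => ?_).trans_lt
      ((show _ < _ from hφ).trans (h4.trans_le (min_le_right _ _)))
    refine (h4.trans_le (min_le_left _ _)).le.trans ?_
    by_contra! hc
    rw [dist_comm] at hc
    exact hj (hUε hc)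
  rw [frac_compl] at h5
  change 1 - δ < frac _
  linarith

variable [Countable G] [IsTopologicalGroup X] [BorelSpace X]

/-- If finitely many microstates are dense at most coordinates, then there are measures on
microstates converging locally to the Haar measure. -/
theorem exists_tendsto_haarProb (hω : IsFree ω)
    (h : ∀ ε : ℝ, 0 < ε → ∃ S : Set (∀ k, Fin (d k) → X), S.Finite ∧ S ⊆ microstates X σ ω ∧
      ∀ᶠ k in ω, frac {j | ¬ ∀ x : X, ∃ ψ ∈ S, dist x (ψ k j) < ε} < ε) :
    ∃ μ : ∀ k, ProbabilityMeasure (Fin (d k) → X),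
      AsympSupportedOnMicrostates σ ω μ ∧ LocalWeakStarTendsto ω μ (haarProb X) := by
  obtain ⟨g, hg⟩ := exists_surjective_nat G
  have hstep : ∀ n : ℕ, ∃ μ : ∀ k, ProbabilityMeasure (Fin (d k) → X), ∀ᶠ k in ω,
      (∀ i ∈ Set.Iic n, μ k {φ | frac {j | 1 / ((n : ℝ) + 1) ≤
        dist (g i • φ j) (φ (σ k (g i) j))} < 1 / ((n : ℝ) + 1)} = 1) ∧
      frac {j | ¬ ∀ f : X → ℝ, LipschitzWith 1 f → (∀ x, |f x| ≤ 1) →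
        |∫ x, f x ∂(marginal (μ k) j : Measure X) - ∫ x, f x ∂(haarProb X : Measure X)| ≤
          1 / ((n : ℝ) + 1)} < 1 / ((n : ℝ) + 1) := by
    intro n
    have hn : 0 < 1 / ((n : ℝ) + 1) := Nat.one_div_pos_of_nat
    obtain ⟨η, hη, hwords⟩ := exists_equidistributing_words (X := X) hn
    obtain ⟨S, hSf, hSM, hS⟩ := h (min η (1 / ((n : ℝ) + 1))) (by positivity)
    -- Inserting the trivial sequence makes the generating family nonempty.
    have := (hSf.insert 1).fintype
    obtain ⟨I, _, p, w, hp, hp1, hpw⟩ := hwords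
      (fun φ : (insert 1 S : Set (∀ k, Fin (d k) → X)) => (⟨φ.1, by
        rcases φ.2 with h1 | h1
        · rw [h1]; exact one_mem _
        · exact hSM h1⟩ : microstates X σ ω))
    refine ⟨fun k => sumDirac p (fun i => (w i).1 k) hp hp1, ?_⟩
    have hmicro : ∀ i ∈ Set.Iic n, ∀ᶠ k in ω, ∀ a, frac {j | 1 / ((n : ℝ) + 1) ≤
        dist (g i • (w a).1 k j) ((w a).1 k (σ k (g i) j))} < 1 / ((n : ℝ) + 1) :=
      fun i _ => eventually_all.2 fun a => isMicrostateSeq_iff.1 (w a).2 (g i) _ hn _ hn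
    filter_upwards [(eventually_all_finite (Set.finite_Iic n)).2 hmicro, hS] with k h1 h2
    refine ⟨fun i hi => sumDirac_apply_eq_one hp hp1 fun a => h1 i hi a, ?_⟩
    refine (frac_mono fun j hj => ?_).trans_lt (h2.trans_le (min_le_right _ _))
    refine fun hdense => hj fun f hf hf1 => ?_
    have hmeas : Measurable f := hf.continuous.measurable
    have hint : ∫ x, f x ∂(marginal (sumDirac p (fun i => (w i).1 k) hp hp1) j : Measure X) =
        ∑ i, p i * f ((w i).1 k j) := by
      rw [marginal, ProbabilityMeasure.toMeasure_map,
        integral_map (measurable_pi_apply j).aemeasurable hmeas.aestronglyMeasurable]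
      exact integral_sumDirac hp hp1 (hmeas.comp (measurable_pi_apply j)).stronglyMeasurable
    rw [hint]
    -- Evaluation at coordinate `j` of level `k` is a homomorphism that carries the fixed law on
    -- words to the `j`-th marginal.
    let e : microstates X σ ω →* X :=
      { toFun := fun φ => φ.1 k j
        map_one' := rfl
        map_mul' := fun _ _ => rfl }
    refine hpw e (fun x => ?_) f hf hf1
    obtain ⟨ψ, hψ, hd⟩ := hdense x
    exact ⟨⟨ψ, Or.inr hψ⟩, hd.trans_le (min_le_left _ _)⟩
  choose μ hμ using hstep
  obtain ⟨N, hN, hdiag⟩ := exists_diagonal hω hμ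
  refine ⟨fun k => μ (N k) k, asympSupported_of_diagonal hg hN (hdiag.mono fun k hk => hk.1), ?_⟩
  intro O hO
  obtain ⟨ε, hε, hclose⟩ := exists_close_subset_nhds hO
  rw [tendsto_unif_iff]
  intro τ hτ
  obtain ⟨n, hn⟩ := exists_nat_one_div_lt (show 0 < min ε τ by positivity)
  filter_upwards [hdiag, hN n] with k h1 h2
  have h3 : 1 / ((N k : ℝ) + 1) < min ε τ := (Nat.one_div_le_one_div h2).trans_lt hn
  refine (frac_mono fun j hj => ?_).trans_lt (h1.2.trans (h3.trans_le (min_le_right _ _)))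
  exact fun hj' => hj (hclose _ fun f hf hf1 =>
    (hj' f hf hf1).trans (h3.trans_le (min_le_left _ _)).le)

end construction

end SoficMicrostates

namespace SoficMicrostates

universe u

variable {G : Type*} {X : Type u} [Group G] [Group X] [MetricSpace X] [CompactSpace X]
  [MulDistribMulAction G X]
  {d : ℕ → ℕ} [∀ k, NeZero (d k)] {σ : ∀ k, G → Equiv.Perm (Fin (d k))} {ω : Ultrafilter ℕ}

/-! ### Absorbing sequences force the hull of Haar marginals -/

section obstruction

/-- Maps satisfying the microstate conditions to increasing accuracy form a microstate sequence. -/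
theorem isMicrostateSeq_of_diagonal {g : ℕ → G} (hg : Function.Surjective g) {N : ℕ → ℕ}
    (hN : ∀ n, ∀ᶠ k in ω, n ≤ N k) {φ : ∀ k, Fin (d k) → X}
    (h : ∀ᶠ k in ω, ∀ i ∈ Set.Iic (N k), frac {j | 1 / ((N k : ℝ) + 1) ≤
      dist (g i • φ k j) (φ k (σ k (g i) j))} ≤ 1 / ((N k : ℝ) + 1)) :
    IsMicrostateSeq σ ω φ := by
  rw [isMicrostateSeq_iff]
  intro g₀ ε hε τ hτ
  obtain ⟨i, rfl⟩ := hg g₀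
  obtain ⟨n, hn⟩ := exists_nat_one_div_lt (show 0 < min ε τ by positivity)
  filter_upwards [h, hN i, hN n] with k h1 h2 h3
  have h4 : 1 / ((N k : ℝ) + 1) < min ε τ := (Nat.one_div_le_one_div h3).trans_lt hn
  refine (frac_mono fun j hj => ?_).trans_lt ((h1 i h2).trans_lt (h4.trans_le (min_le_right _ _)))
  exact (h4.trans_le (min_le_left _ _)).le.trans hj

theorem exists_mem_of_sum_measure_compl_lt {Z ι : Type*} [MeasurableSpace Z] (μ : ProbabilityMeasure Z)
    {B : Set Z} {s : Finset ι} {A : ι → Set Z} (hA : ∀ i ∈ s, MeasurableSet (A i)) {c : ℝ}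
    (hB : c ≤ (μ B : ℝ)) (hc : ∑ i ∈ s, (1 - (μ (A i) : ℝ)) < c) : ∃ z ∈ B, ∀ i ∈ s, z ∈ A i := by
  by_contra! hcon
  have hsub : B ⊆ ⋃ i ∈ s, (A i)ᶜ := fun z hz => by
    obtain ⟨i, hi, hzi⟩ := hcon z hz
    exact Set.mem_iUnion₂.2 ⟨i, hi, hzi⟩
  have h1 : (μ : Measure Z).real B ≤ ∑ i ∈ s, (μ : Measure Z).real (A i)ᶜ :=
    (measureReal_mono hsub (measure_ne_top _ _)).trans (measureReal_biUnion_finset_le _ _)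
  have h2 : ∑ i ∈ s, (μ : Measure Z).real (A i)ᶜ = ∑ i ∈ s, (1 - (μ (A i) : ℝ)) :=
    Finset.sum_congr rfl fun i hi => by
      rw [probReal_compl_eq_one_sub (hA i hi), ProbabilityMeasure.measureReal_eq_coe_coeFn]
  rw [h2, ProbabilityMeasure.measureReal_eq_coe_coeFn] at h1
  linarith

variable [Countable G] [MeasurableSpace X] [BorelSpace X]
  [ContinuousConstSMul G X]

/-- Measures asymptotically supported on microstates concentrate near any absorbing sequence. -/
theorem eventually_measure_far_lt (hω : IsFree ω) {μ : ∀ k, ProbabilityMeasure (Fin (d k) → X)}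
    (hμ : AsympSupportedOnMicrostates σ ω μ) {Y : ∀ k, Fin (d k) → ClosedSubgroup X}
    (hY : AbsorbsMicrostates σ ω Y) {r δ c : ℝ} (hr : 0 < r) (hδ : 0 < δ) (hc : 0 < c) :
    ∀ᶠ k in ω, (μ k {φ | δ ≤ frac {j | r ≤ Metric.infDist (φ j) (Y k j : Set X)}} : ℝ) < c := by
  obtain ⟨g, hg⟩ := exists_surjective_nat G
  by_contra hcon
  -- For an ultrafilter, failing to hold eventually means that the negation holds eventually.
  have hbad := Ultrafilter.eventually_not.2 hcon
  have hstep : ∀ n : ℕ, ∀ᶠ k in ω, ∃ φ : Fin (d k) → X,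
      δ ≤ frac {j | r ≤ Metric.infDist (φ j) (Y k j : Set X)} ∧
      ∀ i ∈ Set.Iic n, frac {j | 1 / ((n : ℝ) + 1) ≤
        dist (g i • φ j) (φ (σ k (g i) j))} ≤ 1 / ((n : ℝ) + 1) := by
    intro n
    have hn : 0 < 1 / ((n : ℝ) + 1) := Nat.one_div_pos_of_nat
    -- There are `n + 1` conditions, so a loss below `c / (n + 2)` for each totals strictly less
    -- than the mass `c` of the bad set.
    have hgood : ∀ i ∈ Set.Iic n, ∀ᶠ k in ω, 1 - c / (n + 2) < (μ k {φ | 1 - 1 / ((n : ℝ) + 1) <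
        frac {j | dist (φ (σ k (g i) j)) (g i • φ j) < 1 / ((n : ℝ) + 1)}} : ℝ) := fun i _ =>
      (tendsto_one_iff fun k => ProbabilityMeasure.apply_le_one _ _).1
        (hμ (g i) {q | dist q.1 q.2 < 1 / ((n : ℝ) + 1)} (isOpen_lt (by fun_prop) (by fun_prop))
          (by rintro ⟨x, y⟩ hxy; simpa [show x = y from hxy] using hn) _ hn) _ (by positivity)
    filter_upwards [hbad, (eventually_all_finite (Set.finite_Iic n)).2 hgood] with k h1 h2
    obtain ⟨φ, hφ, hφ'⟩ := exists_mem_of_sum_measure_compl_lt (μ k) (s := Finset.Iic n)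
      (A := fun i => {φ | 1 - 1 / ((n : ℝ) + 1) <
        frac {j | dist (φ (σ k (g i) j)) (g i • φ j) < 1 / ((n : ℝ) + 1)}})
      (fun i _ => measurableSet_lt measurable_const (measurable_frac fun j =>
        (isOpen_lt (by fun_prop) (by fun_prop)).measurableSet)) (not_lt.1 h1) (by
        refine (Finset.sum_le_card_nsmul _ _ (c / (n + 2)) fun i hi => ?_).trans_lt ?_
        · have := h2 i (Finset.mem_Iic.1 hi)
          linarith
        · rw [Nat.card_Iic, nsmul_eq_mul, mul_div_assoc', div_lt_iff₀ (by positivity)]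
          push_cast
          nlinarith)
    refine ⟨φ, hφ, fun i hi => ?_⟩
    have h3 : 1 - 1 / ((n : ℝ) + 1) < _ := hφ' i (Finset.mem_Iic.2 hi)
    have h4 := frac_compl {j | dist (φ (σ k (g i) j)) (g i • φ j) < 1 / ((n : ℝ) + 1)}
    refine (frac_mono (t := {j | _}ᶜ) fun j hj => ?_).trans (h4.le.trans (by linarith))
    rw [Set.mem_compl_iff]
    intro hj'
    rw [Set.mem_ofPred_eq, dist_comm] at hj'
    exact absurd hj' (not_lt.2 hj)
  obtain ⟨N, hN, hdiag⟩ := exists_diagonal hω hstep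
  have hsel : ∀ k, ∃ φ : Fin (d k) → X, (∃ φ : Fin (d k) → X,
      δ ≤ frac {j | r ≤ Metric.infDist (φ j) (Y k j : Set X)} ∧
      ∀ i ∈ Set.Iic (N k), frac {j | 1 / ((N k : ℝ) + 1) ≤
        dist (g i • φ j) (φ (σ k (g i) j))} ≤ 1 / ((N k : ℝ) + 1)) →
      δ ≤ frac {j | r ≤ Metric.infDist (φ j) (Y k j : Set X)} ∧
      ∀ i ∈ Set.Iic (N k), frac {j | 1 / ((N k : ℝ) + 1) ≤
        dist (g i • φ j) (φ (σ k (g i) j))} ≤ 1 / ((N k : ℝ) + 1) := fun k => by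
    by_cases hk : ∃ φ : Fin (d k) → X, δ ≤ frac {j | r ≤ Metric.infDist (φ j) (Y k j : Set X)} ∧
      ∀ i ∈ Set.Iic (N k), frac {j | 1 / ((N k : ℝ) + 1) ≤
        dist (g i • φ j) (φ (σ k (g i) j))} ≤ 1 / ((N k : ℝ) + 1)
    · exact ⟨hk.choose, fun _ => hk.choose_spec⟩
    · exact ⟨1, fun h => absurd h hk⟩
  choose φ hφ using hsel
  have hφ' := hdiag.mono fun k hk => hφ k hk
  have hmicro : IsMicrostateSeq σ ω φ :=
    isMicrostateSeq_of_diagonal hg hN (hφ'.mono fun k hk => hk.2)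
  have habs := (tendsto_unif_iff _).1 (hY φ hmicro r hr) δ hδ
  obtain ⟨k, h1, h2⟩ := (hφ'.and habs).exists
  refine absurd h2 (not_lt.2 (h1.1.trans (frac_mono fun j hj => ?_)))
  exact not_lt.2 (show r ≤ Metric.infDist (φ k j) (Y k j : Set X) from hj)

omit [CompactSpace X] in
/-- The average mass that the marginals put far from given closed subgroups. -/
theorem mul_frac_marginal_far_le {d : ℕ} [NeZero d] (μ : ProbabilityMeasure (Fin d → X))
    (Y : Fin d → ClosedSubgroup X) {r δ c a : ℝ} (hδ : 0 ≤ δ)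
    (h : (μ {φ | δ ≤ frac {j | r ≤ Metric.infDist (φ j) (Y j : Set X)}} : ℝ) < c) :
    a * frac {j | a ≤ (marginal μ j : Measure X).real
      {x | r ≤ Metric.infDist x (Y j : Set X)}} ≤ δ + c := by
  have hmX : ∀ j, MeasurableSet {x : X | r ≤ Metric.infDist x (Y j : Set X)} := fun j =>
    (isClosed_le continuous_const (Metric.continuous_infDist_pt _)).measurableSet
  have hm : ∀ j, MeasurableSet {φ : Fin d → X | r ≤ Metric.infDist (φ j) (Y j : Set X)} := fun j =>
    (measurable_pi_apply j : Measurable fun φ : Fin d → X => φ j) (hmX j)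
  have hmeas := measurable_frac (p := fun (φ : Fin d → X) j =>
    r ≤ Metric.infDist (φ j) (Y j : Set X)) hm
  refine (mul_frac_le_integral (fun j => measureReal_nonneg) a).trans ?_
  -- Fubini with a finite sum: the mean marginal mass far from `Y` is the expected proportion of far
  -- coordinates.
  have h1 : ∫ j, (marginal μ j : Measure X).real {x | r ≤ Metric.infDist x (Y j : Set X)}
      ∂(unif d : Measure (Fin d)) =
      ∫ φ, frac {j | r ≤ Metric.infDist (φ j) (Y j : Set X)} ∂(μ : Measure (Fin d → X)) := by
    have h2 : (fun φ : Fin d → X => frac {j | r ≤ Metric.infDist (φ j) (Y j : Set X)}) =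
        fun φ => ∑ j, frac {j} *
          {φ : Fin d → X | r ≤ Metric.infDist (φ j) (Y j : Set X)}.indicator 1 φ :=
      funext fun φ => frac_eq_sum_indicator _
    rw [h2, integral_unif, integral_finsetSum _ fun j _ =>
      ((integrable_indicator_one_of_finite (hm j)).const_mul _)]
    refine Finset.sum_congr rfl fun j _ => ?_
    rw [integral_const_mul, integral_indicator_one (hm j), marginal,
      ProbabilityMeasure.toMeasure_map, map_measureReal_apply (measurable_pi_apply j) (hmX j)]
    rfl
  have hset : MeasurableSet {φ : Fin d → X |
      δ ≤ frac {j | r ≤ Metric.infDist (φ j) (Y j : Set X)}} :=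
    measurableSet_le measurable_const hmeas
  rw [h1]
  calc ∫ φ, frac {j | r ≤ Metric.infDist (φ j) (Y j : Set X)} ∂(μ : Measure (Fin d → X))
      ≤ ∫ φ, (δ + {φ : Fin d → X |
        δ ≤ frac {j | r ≤ Metric.infDist (φ j) (Y j : Set X)}}.indicator 1 φ)
          ∂(μ : Measure (Fin d → X)) := by
        refine integral_mono (Integrable.of_bound hmeas.aestronglyMeasurable 1
          (Eventually.of_forall fun φ => ?_))
          ((integrable_const δ).add (integrable_indicator_one_of_finite hset)) fun φ => ?_
        · rw [Real.norm_eq_abs, abs_of_nonneg frac_nonneg]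
          exact frac_le_one
        · by_cases hφ : δ ≤ frac {j | r ≤ Metric.infDist (φ j) (Y j : Set X)}
          · rw [Set.indicator_of_mem (by exact hφ)]
            have := frac_le_one (s := {j | r ≤ Metric.infDist (φ j) (Y j : Set X)})
            simp only [Pi.one_apply]
            linarith
          · rw [Set.indicator_of_notMem (by exact hφ), add_zero]
            exact (not_le.1 hφ).le
    _ ≤ δ + c := by
        rw [integral_add (integrable_const δ) (integrable_indicator_one_of_finite hset),
          integral_indicator_one hset, ProbabilityMeasure.measureReal_eq_coe_coeFn]
        simpa using h.le

variable [IsTopologicalGroup X]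

/-- A closed subgroup near which a measure close to the Haar measure concentrates is close to the
whole group. -/
theorem exists_nhds_haarProb_dist_lt {ε : ℝ} (hε : 0 < ε) :
    ∃ O ∈ 𝓝 (haarProb X), ∃ r > 0, ∃ a > 0, ∀ ν ∈ O, ∀ H : ClosedSubgroup X,
      (ν : Measure X).real {x | r ≤ Metric.infDist x (H : Set X)} < a →
        dist H (wholeGroup X) < ε := by
  set r := ε / 4 with hr_def
  have hr : 0 < r := by positivity
  obtain ⟨t, -, htf, ht⟩ := finite_cover_balls_of_compact (isCompact_univ (X := X)) hr
  have : (haarProb X : Measure X).IsOpenPosMeasure :=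
    inferInstanceAs (Measure.haarMeasure (⊤ : TopologicalSpace.PositiveCompacts X)).IsOpenPosMeasure
  let f (c : X) : BoundedContinuousFunction X ℝ :=
    BoundedContinuousFunction.mkOfCompact ⟨fun x => max 0 (r - dist x c), by fun_prop⟩
  have hf : ∀ c x, f c x = max 0 (r - dist x c) := fun c x => rfl
  have hpos : ∀ c, 0 < ∫ x, f c x ∂(haarProb X : Measure X) := fun c =>
    (f c).continuous.integral_pos_of_hasCompactSupport_nonneg_nonzero
      (HasCompactSupport.of_compactSpace _) (fun x => le_max_left _ _) (x := c)
      (by rw [hf, dist_self, sub_zero, max_eq_right hr.le]; exact hr.ne')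
  -- One positive level lies below the Haar integrals of all the bumps; these strict inequalities
  -- define the neighbourhood.
  obtain ⟨a, ha, ha0⟩ : ∃ a, (∀ c ∈ t, a < ∫ x, f c x ∂(haarProb X : Measure X)) ∧ 0 < a :=
    (((eventually_all_finite htf).2 fun c _ => (eventually_lt_nhds (hpos c)).filter_mono
      nhdsWithin_le_nhds).and (self_mem_nhdsWithin (s := Set.Ioi (0 : ℝ)))).exists
  refine ⟨{ν | ∀ c ∈ t, a < ∫ x, f c x ∂(ν : Measure X)},
    (eventually_all_finite htf).2 fun c hc =>
      (ProbabilityMeasure.continuous_integral_boundedContinuousFunction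
        (f c)).continuousAt.eventually_const_lt (ha c hc), r, hr, a / r, by positivity,
    fun ν hν H hH => ?_⟩
  rw [lt_div_iff₀ hr] at hH
  have hnear : ∀ x : X, ∃ y ∈ H, dist x y ≤ 3 * r := by
    intro x
    obtain ⟨c, hc, hxc⟩ := Set.mem_iUnion₂.1 (ht (Set.mem_univ x))
    rw [Metric.mem_ball] at hxc
    -- If `H` missed the `2 * r`-ball about `c`, the bump at `c` would live where the distance to
    -- `H` is at least `r`. As it is at most `r`, its integral would be below `a`.
    have hy : ∃ y ∈ H, dist c y < 2 * r := by
      by_contra! hfar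
      have hset : MeasurableSet {x | r ≤ Metric.infDist x (H : Set X)} :=
        (isClosed_le continuous_const (Metric.continuous_infDist_pt _)).measurableSet
      have hle : ∀ z, f c z ≤ r * {x | r ≤ Metric.infDist x (H : Set X)}.indicator 1 z := by
        intro z
        rw [hf]
        by_cases hz : r ≤ Metric.infDist z (H : Set X)
        · rw [Set.indicator_of_mem (by exact hz)]
          have := dist_nonneg (x := z) (y := c)
          simp [hr.le]
        · rw [Set.indicator_of_notMem (by exact hz), mul_zero]
          obtain ⟨y, hy, hzy⟩ := (Metric.infDist_lt_iff ⟨1, one_mem H⟩).1 (not_le.1 hz)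
          have h1 := hfar y hy
          have h2 := dist_triangle_left c y z
          exact max_le le_rfl (by linarith)
      have h1 := integral_mono ((f c).integrable (ν : Measure X))
        ((integrable_indicator_one_of_finite hset).const_mul r) hle
      rw [integral_const_mul, integral_indicator_one hset] at h1
      have h2 := hν c hc
      linarith
    obtain ⟨y, hy, hcy⟩ := hy
    exact ⟨y, hy, (dist_triangle x c y).trans (by linarith)⟩
  refine (dist_closedSubgroup_le (K := wholeGroup X) (r := 3 * r) (by positivity) (fun x _ => ⟨x, Set.mem_univ x, ?_⟩)
    fun x _ => hnear x).trans_lt (by linarith)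
  rw [dist_self]
  positivity

theorem tendsto_empirical_of_asympSupported (hω : IsFree ω)
    {μ : ∀ k, ProbabilityMeasure (Fin (d k) → X)} (hμ : AsympSupportedOnMicrostates σ ω μ)
    (hloc : LocalWeakStarTendsto ω μ (haarProb X)) {Y : ∀ k, Fin (d k) → ClosedSubgroup X}
    (hY : AbsorbsMicrostates σ ω Y) :
    Tendsto (fun k => empirical (Y k)) ω (𝓝 (diracProba (wholeGroup X))) := by
  rw [tendsto_empirical_iff]
  intro ε hε
  obtain ⟨O, hO, r, hr, a, ha, hclose⟩ := exists_nhds_haarProb_dist_lt (X := X) hε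
  -- Used as both `δ` and `c`, this sums to `a * (ε / 4)`; cancelling `a` leaves proportion `ε / 4`.
  have hsmall : 0 < a * (ε / 4) / 2 := by positivity
  filter_upwards [eventually_measure_far_lt hω hμ hY hr hsmall hsmall,
    (tendsto_unif_iff _).1 (hloc O hO) (ε / 2) (half_pos hε)] with k h1 h2
  have h3 := mul_frac_marginal_far_le (a := a) (μ k) (Y k) hsmall.le h1
  rw [add_halves] at h3
  have h4 := le_of_mul_le_mul_left h3 ha
  refine (frac_le_add (u := {j | _}) fun j hj => ?_).trans_lt
    ((add_lt_add_of_lt_of_le h2 h4).trans_le (b := ε / 2 + ε / 4) (by linarith))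
  by_contra hc
  simp only [Set.mem_union, Set.mem_compl_iff, Set.mem_ofPred_eq, not_or, not_not, not_le] at hc
  exact absurd (hclose _ hc.1 _ hc.2) (not_lt.2 hj)

end obstruction

end SoficMicrostates

end

/-! ### The equivalence -/

open SoficMicrostates in
theorem corollary1p3 {G X : Type*} [Group G] [Countable G]
    [Group X] [MetricSpace X] [CompactSpace X] [IsTopologicalGroup X]
    [MeasurableSpace X] [BorelSpace X]
    [MulDistribMulAction G X] [ContinuousConstSMul G X]
    (d : ℕ → ℕ) [∀ k, NeZero (d k)]
    (σ : ∀ k, G → Equiv.Perm (Fin (d k))) (hσ : IsSoficApproximation σ)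
    (ω : Ultrafilter ℕ) (hω : IsFree ω) :
    (¬ ∃ μ : ∀ k, ProbabilityMeasure (Fin (d k) → X),
        AsympSupportedOnMicrostates σ ω μ ∧ LocalWeakStarTendsto ω μ (haarProb X)) ↔
      ∃ Y : ∀ k, Fin (d k) → ClosedSubgroup X,
        AbsorbsMicrostates σ ω Y ∧
          ¬ Tendsto (fun k => empirical (Y k)) ω (𝓝 (diracProba (wholeGroup X))) := by
  constructor
  · intro hno
    obtain ⟨Y, hY⟩ := exists_closedSubgroup_hull hω (microstates X σ ω)
    refine ⟨Y, fun φ hφ ε hε => (tendsto_unif_iff _).2 fun τ hτ => ?_, fun hlim => hno ?_⟩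
    · filter_upwards [(hY (min ε τ) (lt_min hε hτ)).1 φ hφ] with k hk
      refine (frac_mono fun j hj => ?_).trans_lt (hk.trans_le (min_le_right _ _))
      rintro ⟨y, hy, hd⟩
      exact hj ((Metric.infDist_le_dist_of_mem hy).trans_lt (hd.trans_le (min_le_left _ _)))
    · rw [tendsto_empirical_iff] at hlim
      -- Every `x` is near a point of the hull, which is near a value of one of finitely many
      -- microstates; each approximation takes half of `ε`.
      refine exists_tendsto_haarProb hω fun ε hε => ?_
      obtain ⟨S, hSf, hSM, hS⟩ := (hY (ε / 2) (half_pos hε)).2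
      refine ⟨S, hSf, hSM, ?_⟩
      filter_upwards [hS, hlim (ε / 2) (half_pos hε)] with k h1 h2
      refine (frac_le_add (u := {j | _}) fun j hj => ?_).trans_lt
        ((add_lt_add h1 h2).trans_eq (add_halves ε))
      by_contra hc
      simp only [Set.mem_union, Set.mem_ofPred_eq, not_or, not_not, not_le] at hc
      refine hj fun x => ?_
      rw [dist_comm] at hc
      obtain ⟨y, hy, hd⟩ := exists_dist_lt_of_dist_lt (x := x) hc.2 trivial
      obtain ⟨ψ, hψ, hd'⟩ := hc.1 y hy
      exact ⟨ψ, hψ, (dist_triangle x y _).trans_lt (by linarith)⟩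
  · rintro ⟨Y, hY, hnot⟩ ⟨μ, hμ, hloc⟩
    exact hnot (tendsto_empirical_of_asympSupported hω hμ hloc hY)
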